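/- There is an absolute constant $C > 0$ such that the following holds. Let $n \geq 1$ be an integer, let $K \geq 1$ be a real number, and let $A \subseteq \mathrm{U}_n(\mathbb{C})$ be a $K$-approximate group; that is, $A$ is a finite set with $1 \in A$ and $a^{-1} \in A$ for all $a \in A$, and there is a finite set $X \subseteq \mathrm{U}_n(\mathbb{C})$ with $X = X^{-1}$, $|X| \leq K$ and $A \cdot A \subseteq X \cdot A$. Then there is a connected abelian subgroup $S \subseteq \mathrm{U}_n(\mathbb{C})$ such that $A$ is contained in the normaliser $N(S)$ of $S$ in $\mathrm{U}_n(\mathbb{C})$ and the image of $A$ under the quotient homomorphism $N(S) \to N(S)/S$ has cardinality at most $n^{Cn^4} K^{Cn^2}$. -/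

import Mathlib

open scoped Pointwise

/-- `A` is a `K`-approximate group in the ambient group `G`: it is a finite symmetric subset
containing the identity, and `A * A` is covered by the left translates of `A` by the elements of
a symmetric set `X` with at most `K` elements. -/
structure IsApproxGroup {G : Type*} [Group G] (K : ℝ) (A : Set G) : Prop where
  one_le : 1 ≤ K
  finite : A.Finite
  one_mem : (1 : G) ∈ A
  inv_mem : ∀ a ∈ A, a⁻¹ ∈ A
  cover : ∃ X : Set G, X.Finite ∧ (∀ x ∈ X, x⁻¹ ∈ X) ∧ (X.ncard : ℝ) ≤ K ∧ A * A ⊆ X * A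

/-- The image of `A ∩ N(S)` under the quotient homomorphism `N(S) → N(S) / S`, where `N(S)` is
the normaliser of the subgroup `S`. -/
def imageInNormalizerQuotient {G : Type*} [Group G] (S : Subgroup G) (A : Set G) :
    Set (Subgroup.normalizer (S : Set G) ⧸ S.subgroupOf (Subgroup.normalizer (S : Set G))) :=
  QuotientGroup.mk' (S.subgroupOf (Subgroup.normalizer (S : Set G))) ''
    {g : Subgroup.normalizer (S : Set G) | (g : G) ∈ A}

/-!
The argument is that of Jordan's theorem on finite linear groups, carried out with the operator
norm on matrices. The factors lost on the way come from the pigeonhole principle, applied to the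
translates of `A` that cover a power of `A` (a power of `K` of them) or to cells of small diameter
that cover the unitary group (`n ^ O(n ^ 2)` of them).

*A dense torus.* Let `H` be a subgroup, initially the whole unitary group, in which `A ^ 2` is
dense: `A ^ 2 ∩ H` is not much smaller than `A`. If some element of `A ^ 2 ∩ H` near `1` is not
central in `H`, take such a `v` of minimal distance to `1`. The commutators of `v` with elements of
`H` near `1` are much closer to `1` than `v`, so two of them in the same translate of `A` differ by
an element `z` of `A ^ 2 ∩ H` which is central by minimality. Then `g v g⁻¹ = v z` for some `g`,
the powers of `z` all stay close to `1`, and `z = 1` as there are no small subgroups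
(`Unitary.eq_one_of_conj_eq_mul`). Hence many elements of `A ^ 2 ∩ H` centralise `v`
(`IsApproxGroup.ncard_inter_le_ncard_inter_centralizer`), and `H` may be replaced by the
centraliser of `v` in `H`. Each replacement enlarges the centre of `H`, more precisely the
dimension of its complex span; this is a commutative star-algebra of `n × n` matrices, so of
dimension at most `n` (`Matrix.finrank_le_of_pairwise_commute`). After at most `n` steps all
elements of `A ^ 2 ∩ H` near `1` are central, and the centre `T` of `H` is an abelian subgroup in
which `A ^ 2` is dense (`IsApproxGroup.exists_isLinearlyClosed_commutative`).

*Making it invariant.* All subgroups that occur are linearly closed, that is, they are the unitary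
groups of star-algebras. Such groups are stable under intersections, satisfy the descending chain
condition through the dimension of their span, and are connected
(`Subgroup.IsLinearlyClosed.isConnected`). Two subgroups in which `A ^ 2` is dense intersect in a
subgroup in which `A ^ 2` is dense (`IsApproxGroup.ncard_inter_mul_ncard_inter_le`). Starting from
`T`, intersect with conjugates of `T` by elements of `A, A ^ 2, …` as long as the intersection
shrinks. This stops after at most `n` steps with a subgroup `S` normalised by `A`
(`IsApproxGroup.exists_isLinearlyClosed_normalized`). As `A ^ 2 ∩ S` is a large part of `A`,
counting translates of it inside `A ^ 3` bounds the number of cosets of `S` that meet `A`.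
-/

/-! ### Counting in approximate groups -/

/-- The pigeonhole principle in the multiplicative form in which it is used throughout. -/
theorem Set.exists_ncard_le_mul_ncard_fiber {α β : Type*} {B : Set α} (hB : B.Finite)
    (hne : B.Nonempty) {Y : Set β} (hY : Y.Finite) {f : α → β} (hf : ∀ b ∈ B, f b ∈ Y) :
    ∃ y, {b ∈ B | f b = y}.Nonempty ∧ B.ncard ≤ Y.ncard * {b ∈ B | f b = y}.ncard := by
  classical
  lift B to Finset α using hB
  lift Y to Finset β using hY
  have hYne : Y.Nonempty := by
    obtain ⟨b, hb⟩ := hne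
    exact ⟨f b, by exact_mod_cast hf b hb⟩
  obtain ⟨y, -, hy⟩ := Y.exists_max_image (fun y => {b ∈ B | f b = y}.card) hYne
  have hle : B.card ≤ Y.card * {b ∈ B | f b = y}.card := by
    rw [Finset.card_eq_sum_card_fiberwise (f := f) (t := Y) (fun b hb => hf b hb)]
    exact (Finset.sum_le_card_nsmul _ _ _ hy).trans_eq (smul_eq_mul _ _)
  have hset : {b ∈ (B : Set α) | f b = y} = (({b ∈ B | f b = y} : Finset α) : Set α) := by
    ext; simp
  refine ⟨y, ?_, ?_⟩
  · rw [hset, Finset.coe_nonempty, ← Finset.card_pos]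
    have : 0 < B.card := Finset.card_pos.2 (by exact_mod_cast hne)
    exact Nat.pos_of_mul_pos_left (this.trans_le hle)
  · rw [hset]
    simpa only [Set.ncard_coe_finset] using hle

namespace IsApproxGroup

variable {G : Type*} [Group G] {K : ℝ} {A : Set G}

theorem pos (hA : IsApproxGroup K A) : 0 < K := one_pos.trans_le hA.one_le

theorem inv_eq (hA : IsApproxGroup K A) : A⁻¹ = A := by
  ext a
  exact ⟨fun h => inv_inv a ▸ hA.inv_mem _ h, fun h => hA.inv_mem _ h⟩

theorem finite_pow (hA : IsApproxGroup K A) (m : ℕ) : (A ^ m).Finite := by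
  induction m with
  | zero => simp
  | succ m ih => rw [pow_succ]; exact ih.mul hA.finite

theorem pow_subset_pow (hA : IsApproxGroup K A) {l m : ℕ} (h : l ≤ m) : A ^ l ⊆ A ^ m :=
  Set.pow_subset_pow_right hA.one_mem h

theorem one_mem_pow (hA : IsApproxGroup K A) (m : ℕ) : (1 : G) ∈ A ^ m :=
  Set.one_mem_pow hA.one_mem

theorem mul_mem_pow {l m : ℕ} {x y : G} (hx : x ∈ A ^ l) (hy : y ∈ A ^ m) :
    x * y ∈ A ^ (l + m) := by
  rw [pow_add]; exact Set.mul_mem_mul hx hy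

theorem inv_mem_pow (hA : IsApproxGroup K A) {m : ℕ} {x : G} (hx : x ∈ A ^ m) :
    x⁻¹ ∈ A ^ m := by
  rw [← Set.mem_inv, ← inv_pow, hA.inv_eq]; exact hx

theorem exists_cover_pow (hA : IsApproxGroup K A) (m : ℕ) :
    ∃ X : Set G, X.Finite ∧ (X.ncard : ℝ) ≤ K ^ m ∧ A ^ (m + 1) ⊆ X * A := by
  obtain ⟨Y, hYfin, -, hYK, hY⟩ := hA.cover
  induction m with
  | zero => exact ⟨{1}, by simp, by simp, by simp⟩
  | succ m ih =>
    obtain ⟨X, hXfin, hXK, hX⟩ := ih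
    refine ⟨X * Y, hXfin.mul hYfin, ?_, ?_⟩
    · calc ((X * Y).ncard : ℝ) ≤ (X.ncard : ℝ) * Y.ncard := by
            exact_mod_cast Set.natCard_mul_le
        _ ≤ K ^ m * K := by
            have := hA.pos
            gcongr
        _ = K ^ (m + 1) := (pow_succ _ _).symm
    · calc A ^ (m + 1 + 1) = A ^ (m + 1) * A := pow_succ _ _
        _ ⊆ X * A * A := Set.mul_subset_mul_right hX
        _ = X * (A * A) := mul_assoc _ _ _
        _ ⊆ X * (Y * A) := Set.mul_subset_mul_left hY
        _ = X * Y * A := (mul_assoc _ _ _).symm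

theorem ncard_pow_le (hA : IsApproxGroup K A) (m : ℕ) :
    ((A ^ (m + 1)).ncard : ℝ) ≤ K ^ m * A.ncard := by
  obtain ⟨X, hXfin, hXK, hX⟩ := hA.exists_cover_pow m
  calc ((A ^ (m + 1)).ncard : ℝ) ≤ ((X * A).ncard : ℝ) := by
        exact_mod_cast Set.ncard_le_ncard hX (hXfin.mul hA.finite)
    _ ≤ (X.ncard : ℝ) * A.ncard := by exact_mod_cast Set.natCard_mul_le
    _ ≤ K ^ m * A.ncard := by gcongr

/-- Pigeonhole over the translates of `A` covering `A ^ (m + 1)`: two points in the same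
left translate of `A` have their quotient in `A ^ 2`. -/
theorem exists_subset_div_mem (hA : IsApproxGroup K A) {α : Type*} {B : Set α} (hB : B.Finite)
    (hne : B.Nonempty) {m : ℕ} {f : α → G} (hf : ∀ b ∈ B, f b ∈ A ^ (m + 1)) :
    ∃ B' ⊆ B, B'.Nonempty ∧ (B.ncard : ℝ) ≤ K ^ m * B'.ncard ∧
      ∀ b ∈ B', ∀ c ∈ B', (f b)⁻¹ * f c ∈ A ^ 2 := by
  obtain ⟨X, hXfin, hXK, hX⟩ := hA.exists_cover_pow m
  have key : ∀ b, ∃ x, b ∈ B → x ∈ X ∧ x⁻¹ * f b ∈ A := fun b => by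
    by_cases hb : b ∈ B
    · obtain ⟨x, hx, a, ha, hxa⟩ := Set.mem_mul.1 (hX (hf b hb))
      exact ⟨x, fun _ => ⟨hx, by rw [← hxa, inv_mul_cancel_left]; exact ha⟩⟩
    · exact ⟨1, fun h => absurd h hb⟩
  choose g hg using key
  obtain ⟨y, hy, hcard⟩ := Set.exists_ncard_le_mul_ncard_fiber hB hne hXfin
    (fun b hb => (hg b hb).1)
  refine ⟨_, Set.sep_subset _ _, hy, ?_, ?_⟩
  · calc (B.ncard : ℝ) ≤ (X.ncard : ℝ) * {b ∈ B | g b = y}.ncard := by exact_mod_cast hcard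
      _ ≤ _ := by gcongr
  · rintro b ⟨hb, rfl⟩ c ⟨hc, hcb⟩
    have h1 := hA.inv_mem _ (hg b hb).2
    have h2 := (hg c hc).2
    rw [hcb] at h2
    rw [pow_two]
    convert Set.mul_mem_mul h1 h2 using 1
    group

/-- A set all of whose quotients lie in the finite set `D` has at most as many elements as `D`. -/
theorem _root_.Set.ncard_le_of_div_mem {B D : Set G} (hD : D.Finite) (hne : B.Nonempty)
    (h : ∀ b ∈ B, ∀ c ∈ B, b⁻¹ * c ∈ D) : B.ncard ≤ D.ncard := by
  obtain ⟨b, hb⟩ := hne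
  exact Set.ncard_le_ncard_of_injOn (fun c => b⁻¹ * c) (fun c hc => h b hb c hc)
    (fun _ _ _ _ h => mul_left_cancel h) hD

theorem ncard_pow_inter_le (hA : IsApproxGroup K A) (m : ℕ) (H : Subgroup G) :
    ((A ^ (m + 1) ∩ H : Set G).ncard : ℝ) ≤ K ^ m * (A ^ 2 ∩ H : Set G).ncard := by
  obtain ⟨B', hB', hne, hcard, hdiv⟩ := hA.exists_subset_div_mem
    ((hA.finite_pow (m + 1)).inter_of_left (H : Set G))
    ⟨1, hA.one_mem_pow _, H.one_mem⟩ (f := id) (fun b hb => hb.1)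
  refine hcard.trans ?_
  have : B'.ncard ≤ (A ^ 2 ∩ H : Set G).ncard :=
    Set.ncard_le_of_div_mem ((hA.finite_pow 2).inter_of_left _) hne fun b hb c hc =>
      ⟨hdiv b hb c hc, H.mul_mem (H.inv_mem (hB' hb).2) (hB' hc).2⟩
  have := hA.pos
  gcongr

theorem ncard_sq_inter_pos (hA : IsApproxGroup K A) (H : Subgroup G) :
    0 < (A ^ 2 ∩ H : Set G).ncard :=
  (Set.ncard_pos ((hA.finite_pow 2).inter_of_left _)).2 ⟨1, hA.one_mem_pow _, H.one_mem⟩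

/-- Two subgroups that are both dense in `A ^ 2` have an intersection that is dense in `A ^ 2`:
the fibres of the multiplication map have all their quotients in the intersection. -/
theorem ncard_inter_mul_ncard_inter_le (hA : IsApproxGroup K A) (S T : Subgroup G) :
    ((A ^ 2 ∩ S : Set G).ncard : ℝ) * (A ^ 2 ∩ T : Set G).ncard ≤
      K ^ 6 * A.ncard * (A ^ 2 ∩ (S ⊓ T : Subgroup G) : Set G).ncard := by
  have hS := (hA.finite_pow 2).inter_of_left (S : Set G)
  have hT := (hA.finite_pow 2).inter_of_left (T : Set G)
  obtain ⟨y, hy, hcard⟩ := Set.exists_ncard_le_mul_ncard_fiber (hS.prod hT)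
    ⟨(1, 1), ⟨hA.one_mem_pow _, S.one_mem⟩, ⟨hA.one_mem_pow _, T.one_mem⟩⟩ (hA.finite_pow 4)
    (f := fun p : G × G => p.1 * p.2) (fun p hp => mul_mem_pow hp.1.1 hp.2.1)
  set F := {p ∈ (A ^ 2 ∩ S : Set G) ×ˢ (A ^ 2 ∩ T : Set G) | p.1 * p.2 = y}
  obtain ⟨p, hp, hpy⟩ := hy
  have hF : F.ncard ≤ (A ^ 4 ∩ (S ⊓ T : Subgroup G) : Set G).ncard := by
    refine Set.ncard_le_ncard_of_injOn (fun q => p.1⁻¹ * q.1) ?_ ?_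
      ((hA.finite_pow 4).inter_of_left _)
    · rintro q ⟨hq, hqy⟩
      refine ⟨mul_mem_pow (hA.inv_mem_pow hp.1.1) hq.1.1,
        S.mul_mem (S.inv_mem hp.1.2) hq.1.2, ?_⟩
      have : p.1⁻¹ * q.1 = p.2 * q.2⁻¹ := by
        rw [inv_mul_eq_iff_eq_mul, ← mul_assoc, hpy, ← hqy, mul_inv_cancel_right]
      rw [this]
      exact T.mul_mem hp.2.2 (T.inv_mem hq.2.2)
    · rintro q ⟨-, hqy⟩ r ⟨-, hry⟩ h
      have h1 : q.1 = r.1 := mul_left_cancel h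
      refine Prod.ext h1 (mul_left_cancel (a := q.1) ?_)
      rw [hqy, h1, hry]
  rw [Set.ncard_prod] at hcard
  have hK := hA.pos
  calc ((A ^ 2 ∩ S : Set G).ncard : ℝ) * (A ^ 2 ∩ T : Set G).ncard
      ≤ ((A ^ 4).ncard : ℝ) * F.ncard := by exact_mod_cast hcard
    _ ≤ (K ^ 3 * A.ncard) * (K ^ 3 * (A ^ 2 ∩ (S ⊓ T : Subgroup G) : Set G).ncard) := by
        gcongr
        · exact hA.ncard_pow_le 3
        · exact (Nat.cast_le.2 hF).trans (hA.ncard_pow_inter_le 3 _)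
    _ = _ := by ring

/-- Conjugating by a word of length `j` costs a factor `K ^ (2 * j + 1)` in density. -/
theorem ncard_inter_le_ncard_inter_conj (hA : IsApproxGroup K A) (T : Subgroup G) {j : ℕ} {w : G}
    (hw : w ∈ A ^ j) :
    ((A ^ 2 ∩ T : Set G).ncard : ℝ) ≤
      K ^ (2 * j + 1) * (A ^ 2 ∩ (T.map (MulAut.conj w).toMonoidHom : Subgroup G) : Set G).ncard := by
  refine le_trans ?_ (hA.ncard_pow_inter_le (2 * j + 1) _)
  refine Nat.cast_le.2 (Set.ncard_le_ncard_of_injOn (fun x => w * x * w⁻¹) ?_ ?_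
    ((hA.finite_pow _).inter_of_left _))
  · rintro x ⟨hx, hxT⟩
    refine ⟨?_, Subgroup.mem_map.2 ⟨x, hxT, rfl⟩⟩
    have := mul_mem_pow (mul_mem_pow hw hx) (hA.inv_mem_pow hw)
    convert this using 2
    ring
  · intro x _ y _ h
    simpa using h

/-- The cosets of `S` meeting `A` are counted by their translates of `A ^ 2 ∩ S` inside
`A ^ 3`. -/
theorem ncard_image_mul_ncard_inter_le (hA : IsApproxGroup K A) (S : Subgroup G) :
    ((imageInNormalizerQuotient S A).ncard : ℝ) * (A ^ 2 ∩ S : Set G).ncard ≤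
      K ^ 2 * A.ncard := by
  have key : ∀ q, ∃ g : Subgroup.normalizer (S : Set G), q ∈ imageInNormalizerQuotient S A →
      (g : G) ∈ A ∧ QuotientGroup.mk' (S.subgroupOf (Subgroup.normalizer (S : Set G))) g = q := by
    intro q
    by_cases hq : q ∈ imageInNormalizerQuotient S A
    · obtain ⟨g, hg, hgq⟩ := hq
      exact ⟨g, fun _ => ⟨hg, hgq⟩⟩
    · exact ⟨1, fun h => absurd h hq⟩
  choose s hs using key
  refine le_trans ?_ (hA.ncard_pow_le 2)
  rw [← Nat.cast_mul, ← Set.ncard_prod]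
  refine Nat.cast_le.2 (Set.ncard_le_ncard_of_injOn (fun p => (s p.1 : G) * p.2) ?_ ?_
    (hA.finite_pow _))
  · rintro p ⟨hp1, hp2⟩
    have h1 : (s p.1 : G) ∈ A ^ 1 := by rw [pow_one]; exact (hs _ hp1).1
    exact mul_mem_pow (l := 1) (m := 2) h1 hp2.1
  · rintro p ⟨hp1, hp2⟩ r ⟨hr1, hr2⟩ h
    have h1 : p.1 = r.1 := by
      rw [← (hs _ hp1).2, ← (hs _ hr1).2]
      refine QuotientGroup.eq.2 (Subgroup.mem_subgroupOf.2 ?_)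
      have h' : (s p.1 : G) * p.2 = s r.1 * r.2 := h
      have : (s p.1 : G)⁻¹ * s r.1 = p.2 * r.2⁻¹ := by
        rw [inv_mul_eq_iff_eq_mul, ← mul_assoc, h', mul_inv_cancel_right]
      rw [Subgroup.coe_mul, Subgroup.coe_inv, this]
      exact S.mul_mem hp2.2 (S.inv_mem hr2.2)
    refine Prod.ext h1 ?_
    have h' : (s p.1 : G) * p.2 = s r.1 * r.2 := h
    rw [h1] at h'
    exact mul_left_cancel h'

end IsApproxGroup

/-! ### Unitaries close to the identity -/

section UnitaryNorm

variable {E : Type*} [CStarAlgebra E]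

theorem Unitary.norm_inv_mul_sub_one (u v : unitary E) :
    ‖((u⁻¹ * v : unitary E) : E) - 1‖ = ‖(v : E) - u‖ := by
  rw [← CStarRing.norm_coe_unitary_mul u]
  congr 1
  rw [mul_sub, mul_one, ← Submonoid.coe_mul, mul_inv_cancel_left]

theorem Unitary.norm_mul_sub_one_le (u v : unitary E) :
    ‖((u * v : unitary E) : E) - 1‖ ≤ ‖(u : E) - 1‖ + ‖(v : E) - 1‖ := by
  have h : ((u * v : unitary E) : E) - 1 = ((u : E) - 1) + u * ((v : E) - 1) := by
    rw [Submonoid.coe_mul]; noncomm_ring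
  rw [h, ← CStarRing.norm_coe_unitary_mul u ((v : E) - 1)]
  exact norm_add_le _ _

theorem Unitary.norm_inv_sub_one (u : unitary E) :
    ‖((u⁻¹ : unitary E) : E) - 1‖ = ‖(u : E) - 1‖ := by
  have := Unitary.norm_inv_mul_sub_one u 1
  rwa [mul_one, OneMemClass.coe_one, norm_sub_rev 1] at this

theorem Unitary.norm_conj_sub_one (u v : unitary E) :
    ‖((u * v * u⁻¹ : unitary E) : E) - 1‖ = ‖(v : E) - 1‖ := by
  rw [← CStarRing.norm_mul_coe_unitary _ u, ← CStarRing.norm_coe_unitary_mul u ((v : E) - 1)]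
  congr 1
  rw [sub_mul, one_mul, ← Submonoid.coe_mul, inv_mul_cancel_right, Submonoid.coe_mul, mul_sub,
    mul_one]

/-- The commutator of two unitaries close to `1` is quadratically close to `1`. -/
theorem Unitary.norm_commutator_sub_one_le (u v : unitary E) :
    ‖((u * v * u⁻¹ * v⁻¹ : unitary E) : E) - 1‖ ≤ 2 * ‖(u : E) - 1‖ * ‖(v : E) - 1‖ := by
  have h : ‖((u * v * u⁻¹ * v⁻¹ : unitary E) : E) - 1‖ =
      ‖((u : E) - 1) * ((v : E) - 1) - ((v : E) - 1) * ((u : E) - 1)‖ := by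
    rw [← CStarRing.norm_mul_coe_unitary _ (v * u)]
    congr 1
    rw [sub_mul, one_mul, ← Submonoid.coe_mul]
    have : u * v * u⁻¹ * v⁻¹ * (v * u) = u * v := by group
    rw [this, Submonoid.coe_mul, Submonoid.coe_mul]
    noncomm_ring
  rw [h]
  refine (norm_sub_le _ _).trans ?_
  have h1 := norm_mul_le ((u : E) - 1) ((v : E) - 1)
  have h2 := norm_mul_le ((v : E) - 1) ((u : E) - 1)
  linarith

/-- There are no small subgroups: a unitary whose powers all stay close to `1` is trivial. The
distance to `1` grows by a factor at least `3 / 2` under each squaring. -/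
theorem Unitary.eq_one_of_forall_norm_pow_sub_one_le (z : unitary E)
    (h : ∀ k : ℕ, ‖((z ^ k : unitary E) : E) - 1‖ ≤ 1 / 2) : z = 1 := by
  have grow : ∀ w : unitary E, ‖(w : E) - 1‖ ≤ 1 / 2 →
      3 / 2 * ‖(w : E) - 1‖ ≤ ‖((w ^ 2 : unitary E) : E) - 1‖ := by
    intro w hw
    have h1 : 2 • ((w : E) - 1) =
        (((w ^ 2 : unitary E) : E) - 1) - ((w : E) - 1) * ((w : E) - 1) := by
      rw [SubmonoidClass.coe_pow]; noncomm_ring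
    have h2 : ‖(2 : ℕ) • ((w : E) - 1)‖ = 2 * ‖(w : E) - 1‖ := by
      rw [← Nat.cast_smul_eq_nsmul ℝ, norm_smul]
      norm_num
    have h3 := norm_sub_le (((w ^ 2 : unitary E) : E) - 1) (((w : E) - 1) * ((w : E) - 1))
    have h4 := norm_mul_le ((w : E) - 1) ((w : E) - 1)
    rw [← h1, h2] at h3
    nlinarith [norm_nonneg ((w : E) - 1)]
  have iter : ∀ k : ℕ, (3 / 2 : ℝ) ^ k * ‖(z : E) - 1‖ ≤ 1 / 2 := by
    intro k
    refine le_trans ?_ (h (2 ^ k))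
    induction k with
    | zero => simp
    | succ k ih =>
      have := grow (z ^ 2 ^ k) (h _)
      rw [← pow_mul, ← pow_succ] at this
      rw [pow_succ]
      linarith
  by_contra hz
  have hpos : 0 < ‖(z : E) - 1‖ := by
    rw [norm_pos_iff, sub_ne_zero]
    exact fun h => hz (Subtype.ext h)
  obtain ⟨k, hk⟩ := pow_unbounded_of_one_lt (1 / ‖(z : E) - 1‖) (by norm_num : (1 : ℝ) < 3 / 2)
  rw [div_lt_iff₀ hpos] at hk
  linarith [iter k]

/-- If `g * v * g⁻¹ = v * z` with `z` commuting with `g`, and `v` is close to `1`, then `z = 1`,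
so that `g` commutes with `v`: the powers `z ^ k = v⁻¹ * g ^ k * v * g ^ (-k)` all remain close to `1`. -/
theorem Unitary.eq_one_of_conj_eq_mul {g v z : unitary E} (hv : ‖(v : E) - 1‖ ≤ 1 / 4)
    (h : g * v * g⁻¹ = v * z) (hg : Commute z g) : z = 1 := by
  refine Unitary.eq_one_of_forall_norm_pow_sub_one_le z fun k => ?_
  have hk : g ^ k * v * (g ^ k)⁻¹ = v * z ^ k := by
    induction k with
    | zero => simp
    | succ k ih =>
      calc g ^ (k + 1) * v * (g ^ (k + 1))⁻¹ = g * (g ^ k * v * (g ^ k)⁻¹) * g⁻¹ := by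
            rw [pow_succ']; group
        _ = (g * v * g⁻¹) * (g * z ^ k * g⁻¹) := by rw [ih]; group
        _ = (v * z) * z ^ k := by
            rw [h, ← (hg.pow_left k).eq, mul_inv_cancel_right]
        _ = v * z ^ (k + 1) := by rw [pow_succ']; group
  have hz : z ^ k = v⁻¹ * (g ^ k * v * (g ^ k)⁻¹) := by rw [hk, inv_mul_cancel_left]
  rw [hz]
  refine (Unitary.norm_mul_sub_one_le _ _).trans ?_
  rw [Unitary.norm_conj_sub_one, Unitary.norm_inv_sub_one]
  linarith

end UnitaryNorm

/-! ### Covering the unitary group by small cells -/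

section OperatorNorm

open scoped Matrix.Norms.L2Operator

theorem Matrix.l2_opNorm_single_le {n : ℕ} (i j : Fin n) (c : ℂ) :
    ‖(Matrix.single i j c : Matrix (Fin n) (Fin n) ℂ)‖ ≤ ‖c‖ := by
  have h := CStarRing.norm_self_mul_star (x := (Matrix.single i j c : Matrix (Fin n) (Fin n) ℂ))
  have h2 : Matrix.single i j c * star (Matrix.single i j c : Matrix (Fin n) (Fin n) ℂ) =
      Matrix.diagonal (Pi.single i (c * star c)) := by
    rw [Matrix.star_eq_conjTranspose, Matrix.conjTranspose_single, Matrix.single_mul_single_same,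
      Matrix.diagonal_single]
  rw [h2, Matrix.l2_opNorm_diagonal, Pi.norm_single, norm_mul, norm_star] at h
  nlinarith [norm_nonneg (Matrix.single i j c : Matrix (Fin n) (Fin n) ℂ), norm_nonneg c]

theorem Matrix.l2_opNorm_le_of_entry_le {n : ℕ} {M : Matrix (Fin n) (Fin n) ℂ} {r : ℝ}
    (h : ∀ i j, ‖M i j‖ ≤ r) : ‖M‖ ≤ n ^ 2 * r := by
  conv_lhs => rw [Matrix.matrix_eq_sum_single M]
  calc ‖∑ i, ∑ j, Matrix.single i j (M i j)‖ ≤ ∑ i : Fin n, ∑ j : Fin n, r :=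
        (norm_sum_le _ _).trans (Finset.sum_le_sum fun i _ => (norm_sum_le _ _).trans
          (Finset.sum_le_sum fun j _ => (Matrix.l2_opNorm_single_le i j _).trans (h i j)))
    _ = n ^ 2 * r := by simp; ring

/-- The number of cells of a grid of mesh `1 / (16 n ^ 2)`, in the real and imaginary parts of the
entries, needed to cover the unitary group. -/
def gridCells (n : ℕ) : ℕ := (32 * n ^ 2 + 1) ^ (2 * n ^ 2)

theorem gridCells_pos (n : ℕ) : 0 < gridCells n := by unfold gridCells; positivity

theorem gridCells_le {n : ℕ} (hn : 2 ≤ n) : gridCells n ≤ n ^ (16 * n ^ 2) := by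
  have h : 32 * n ^ 2 + 1 ≤ n ^ 8 := by
    have h4 : 2 ^ 6 ≤ n ^ 6 := Nat.pow_le_pow_left hn 6
    have h2 : 2 ^ 2 ≤ n ^ 2 := Nat.pow_le_pow_left hn 2
    calc 32 * n ^ 2 + 1 ≤ 2 ^ 6 * n ^ 2 := by omega
      _ ≤ n ^ 6 * n ^ 2 := Nat.mul_le_mul_right _ h4
      _ = n ^ 8 := by ring
  calc gridCells n ≤ (n ^ 8) ^ (2 * n ^ 2) := Nat.pow_le_pow_left h _
    _ = n ^ (16 * n ^ 2) := by rw [← pow_mul]; ring_nf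

theorem abs_sub_le_of_floor_mul_eq {m : ℕ} (hm : 0 < m) {x y : ℝ} (h : ⌊m * x⌋ = ⌊m * y⌋) :
    |x - y| ≤ 1 / m := by
  have hm' : (0 : ℝ) < m := by exact_mod_cast hm
  have := Int.abs_sub_lt_one_of_floor_eq_floor h
  rw [← mul_sub, abs_mul, abs_of_pos hm'] at this
  rw [le_div_iff₀ hm']
  linarith

theorem floor_mul_mem_Icc {m : ℕ} {x : ℝ} (h : |x| ≤ 1) :
    ⌊m * x⌋ ∈ Finset.Icc (-(m : ℤ)) m := by
  obtain ⟨h1, h2⟩ := abs_le.1 h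
  have hm : (0 : ℝ) ≤ m := Nat.cast_nonneg m
  rw [Finset.mem_Icc]
  constructor
  · rw [Int.le_floor]; push_cast; nlinarith
  · have : ((⌊m * x⌋ : ℤ) : ℝ) ≤ m := (Int.floor_le _).trans (by nlinarith)
    exact_mod_cast this

/-- Among finitely many unitary matrices, a proportion at least `1 / gridCells n` lies in a set of
diameter at most `1 / 8`. -/
theorem exists_subset_norm_div_sub_one_le {n : ℕ} (hn : 1 ≤ n)
    {B : Set (Matrix.unitaryGroup (Fin n) ℂ)} (hB : B.Finite) (hne : B.Nonempty) :
    ∃ B' ⊆ B, B'.Nonempty ∧ B.ncard ≤ gridCells n * B'.ncard ∧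
      ∀ b ∈ B', ∀ c ∈ B',
        ‖((b⁻¹ * c : Matrix.unitaryGroup (Fin n) ℂ) : Matrix (Fin n) (Fin n) ℂ) - 1‖ ≤ 1 / 8 := by
  set m := 16 * n ^ 2 with hm
  have hmpos : 0 < m := by positivity
  let cell : Matrix.unitaryGroup (Fin n) ℂ → Fin n → Fin n → ℤ × ℤ := fun u i j =>
    (⌊m * (u.1 i j).re⌋, ⌊m * (u.1 i j).im⌋)
  let Y : Finset (Fin n → Fin n → ℤ × ℤ) :=
    Fintype.piFinset fun _ => Fintype.piFinset fun _ =>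
      Finset.Icc (-(m : ℤ)) m ×ˢ Finset.Icc (-(m : ℤ)) m
  have hcard : Y.card = gridCells n := by
    simp only [Y, Fintype.card_piFinset, Finset.card_product, Int.card_Icc, Finset.prod_const,
      Finset.card_univ, Fintype.card_fin, gridCells]
    have : ((m : ℤ) + 1 - -(m : ℤ)).toNat = 32 * n ^ 2 + 1 := by omega
    rw [this, ← pow_two, ← pow_mul, ← pow_mul]
    ring_nf
  obtain ⟨y, hy, hle⟩ := Set.exists_ncard_le_mul_ncard_fiber hB hne (Finset.finite_toSet Y)
    (f := cell) (fun u _ => by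
      simp only [Y, Finset.mem_coe, Fintype.mem_piFinset, Finset.mem_product]
      intro i j
      have := entry_norm_bound_of_unitary u.2 i j
      exact ⟨floor_mul_mem_Icc ((Complex.abs_re_le_norm _).trans this),
        floor_mul_mem_Icc ((Complex.abs_im_le_norm _).trans this)⟩)
  rw [Set.ncard_coe_finset, hcard] at hle
  refine ⟨_, Set.sep_subset _ _, hy, hle, ?_⟩
  rintro b ⟨-, hb⟩ c ⟨-, hc⟩
  rw [Unitary.norm_inv_mul_sub_one]
  have hentry : ∀ i j, ‖(c.1 - b.1) i j‖ ≤ 2 / m := by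
    intro i j
    have h : cell c i j = cell b i j := by rw [hb, hc]
    have h1 := abs_sub_le_of_floor_mul_eq hmpos (congrArg Prod.fst h)
    have h2 := abs_sub_le_of_floor_mul_eq hmpos (congrArg Prod.snd h)
    rw [← Complex.sub_re] at h1
    rw [← Complex.sub_im] at h2
    calc ‖(c.1 - b.1) i j‖ ≤ |((c.1 - b.1) i j).re| + |((c.1 - b.1) i j).im| :=
          Complex.norm_le_abs_re_add_abs_im _
      _ ≤ 1 / m + 1 / m := add_le_add h1 h2
      _ = 2 / m := by ring
  refine (Matrix.l2_opNorm_le_of_entry_le hentry).trans (le_of_eq ?_)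
  have : (n : ℝ) ≠ 0 := by positivity
  rw [hm]
  push_cast
  field_simp
  norm_num

/-! ### Centralising an element of minimal distance to the identity -/

namespace IsApproxGroup

variable {n : ℕ} {K : ℝ} {A : Set (Matrix.unitaryGroup (Fin n) ℂ)}

/-- The step of the Jordan-type argument: if `v` is a non-central element of `A ^ 2 ∩ H` which is
closest to `1`, then a large part of `A ^ 2 ∩ H` centralises `v`. -/
theorem ncard_inter_le_ncard_inter_centralizer (hA : IsApproxGroup K A) (hn : 1 ≤ n)
    {H : Subgroup (Matrix.unitaryGroup (Fin n) ℂ)} {v : Matrix.unitaryGroup (Fin n) ℂ}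
    (hvA : v ∈ A ^ 2) (hvH : v ∈ H) (hvc : v ∉ Subgroup.centralizer (H : Set _))
    (hv : ‖(v : Matrix (Fin n) (Fin n) ℂ) - 1‖ ≤ 1 / 8)
    (hmin : ∀ z ∈ A ^ 2, z ∈ H → ‖(z : Matrix (Fin n) (Fin n) ℂ) - 1‖ <
      ‖(v : Matrix (Fin n) (Fin n) ℂ) - 1‖ → z ∈ Subgroup.centralizer (H : Set _)) :
    ((A ^ 2 ∩ H : Set _).ncard : ℝ) ≤ gridCells n * K ^ 14 *
      (A ^ 2 ∩ (H ⊓ Subgroup.centralizer {v} : Subgroup _) : Set _).ncard := by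
  have hKpos := hA.pos
  have hfin := (hA.finite_pow 2).inter_of_left (H : Set (Matrix.unitaryGroup (Fin n) ℂ))
  obtain ⟨B₁, hB₁, ⟨b₀, hb₀⟩, hcard₁, hdiv₁⟩ := exists_subset_norm_div_sub_one_le hn hfin
    ⟨1, hA.one_mem_pow _, H.one_mem⟩
  have hvpos : 0 < ‖(v : Matrix (Fin n) (Fin n) ℂ) - 1‖ := by
    rw [norm_pos_iff, sub_ne_zero]
    intro h
    have : v = 1 := Subtype.ext h
    exact hvc (this ▸ Subgroup.one_mem _)
  obtain ⟨B₂, hB₂, hne₂, hcard₂, hdiv₂⟩ := hA.exists_subset_div_mem (hfin.subset hB₁) ⟨b₀, hb₀⟩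
    (m := 11) (f := fun b => (b₀⁻¹ * b) * v * (b₀⁻¹ * b)⁻¹ * v⁻¹) (fun b hb => by
      have h1 : b₀⁻¹ * b ∈ A ^ 4 :=
        mul_mem_pow (l := 2) (m := 2) (hA.inv_mem_pow (hB₁ hb₀).1) (hB₁ hb).1
      exact mul_mem_pow (l := 10) (m := 2) (mul_mem_pow (l := 6) (m := 4)
        (mul_mem_pow (l := 4) (m := 2) h1 hvA) (hA.inv_mem_pow h1)) (hA.inv_mem_pow hvA))
  have hcomm : ∀ b ∈ B₂, ∀ c ∈ B₂,
      b⁻¹ * c ∈ A ^ 4 ∩ (H ⊓ Subgroup.centralizer {v} : Subgroup _) := by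
    intro b hb c hc
    have hbH := (hB₁ (hB₂ hb)).2
    have hcH := (hB₁ (hB₂ hc)).2
    have hb₀H := (hB₁ hb₀).2
    set p := b₀⁻¹ * b with hp
    set q := b₀⁻¹ * c with hq
    have hpH : p ∈ H := H.mul_mem (H.inv_mem hb₀H) hbH
    have hqH : q ∈ H := H.mul_mem (H.inv_mem hb₀H) hcH
    set z := (p * v * p⁻¹ * v⁻¹)⁻¹ * (q * v * q⁻¹ * v⁻¹) with hz
    have hzA : z ∈ A ^ 2 := hdiv₂ b hb c hc
    have hzH : z ∈ H := by
      have hx : ∀ x ∈ H, x * v * x⁻¹ * v⁻¹ ∈ H := fun x hx =>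
        H.mul_mem (H.mul_mem (H.mul_mem hx hvH) (H.inv_mem hx)) (H.inv_mem hvH)
      exact H.mul_mem (H.inv_mem (hx p hpH)) (hx q hqH)
    -- Both commutators are within `‖v - 1‖ / 4` of `1`, so their quotient `z` is closer than `v`.
    have hzsmall : ‖(z : Matrix (Fin n) (Fin n) ℂ) - 1‖ <
        ‖(v : Matrix (Fin n) (Fin n) ℂ) - 1‖ := by
      refine (Unitary.norm_mul_sub_one_le _ _).trans_lt ?_
      rw [Unitary.norm_inv_sub_one]
      have h1 := Unitary.norm_commutator_sub_one_le p v
      have h2 := Unitary.norm_commutator_sub_one_le q v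
      have h3 := hdiv₁ b₀ hb₀ b (hB₂ hb)
      have h4 := hdiv₁ b₀ hb₀ c (hB₂ hc)
      nlinarith
    have hzc := Subgroup.mem_centralizer_iff.1 (hmin z hzA hzH hzsmall)
    have hconj : (p⁻¹ * q) * v * (p⁻¹ * q)⁻¹ = v * z := by
      have h1 : q * v * q⁻¹ = p * v * p⁻¹ * z := by
        have h2 : q * v * q⁻¹ = (p * v * p⁻¹ * v⁻¹) * z * v := by rw [hz]; group
        rw [h2, mul_assoc _ z v, ← hzc v hvH]; group
      calc (p⁻¹ * q) * v * (p⁻¹ * q)⁻¹ = p⁻¹ * (q * v * q⁻¹) * p := by group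
        _ = v * (p⁻¹ * z * p) := by rw [h1]; group
        _ = v * z := by rw [mul_assoc p⁻¹, ← hzc p hpH, inv_mul_cancel_left]
    have hz1 : z = 1 := Unitary.eq_one_of_conj_eq_mul (hv.trans (by norm_num)) hconj
      (hzc _ (H.mul_mem (H.inv_mem hpH) hqH)).symm
    have hpq : p⁻¹ * q = b⁻¹ * c := by rw [hp, hq]; group
    rw [hz1, mul_one, hpq, mul_inv_eq_iff_eq_mul] at hconj
    refine ⟨mul_mem_pow (l := 2) (m := 2) (hA.inv_mem_pow (hB₁ (hB₂ hb)).1) (hB₁ (hB₂ hc)).1,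
      H.mul_mem (H.inv_mem hbH) hcH, Subgroup.mem_centralizer_iff.2 ?_⟩
    rintro _ rfl
    exact hconj.symm
  have hcard₃ : (B₂.ncard : ℝ) ≤
      K ^ 3 * (A ^ 2 ∩ (H ⊓ Subgroup.centralizer {v} : Subgroup _) : Set _).ncard :=
    (Nat.cast_le.2 (Set.ncard_le_of_div_mem ((hA.finite_pow 4).inter_of_left _) hne₂ hcomm)).trans
      (hA.ncard_pow_inter_le 3 _)
  calc ((A ^ 2 ∩ H : Set _).ncard : ℝ) ≤ gridCells n * B₁.ncard := by exact_mod_cast hcard₁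
    _ ≤ gridCells n * (K ^ 11 * (K ^ 3 *
        (A ^ 2 ∩ (H ⊓ Subgroup.centralizer {v} : Subgroup _) : Set _).ncard)) := by
      gcongr
      exact hcard₂.trans (by gcongr)
    _ = _ := by ring

/-- If all elements of `A ^ 2 ∩ H` close to `1` are central in `H`, then a large part of
`A ^ 2 ∩ H` is central in `H`. -/
theorem ncard_inter_le_ncard_inter_center (hA : IsApproxGroup K A) (hn : 1 ≤ n)
    {H : Subgroup (Matrix.unitaryGroup (Fin n) ℂ)}
    (h : ∀ z ∈ A ^ 2, z ∈ H → ‖(z : Matrix (Fin n) (Fin n) ℂ) - 1‖ ≤ 1 / 8 →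
      z ∈ Subgroup.centralizer (H : Set _)) :
    ((A ^ 2 ∩ H : Set _).ncard : ℝ) ≤ gridCells n * K *
      (A ^ 2 ∩ (H ⊓ Subgroup.centralizer (H : Set _) : Subgroup _) : Set _).ncard := by
  have hKpos := hA.pos
  have hfin := (hA.finite_pow 2).inter_of_left (H : Set (Matrix.unitaryGroup (Fin n) ℂ))
  obtain ⟨B₁, hB₁, hne₁, hcard₁, hdiv₁⟩ := hA.exists_subset_div_mem hfin
    ⟨1, hA.one_mem_pow _, H.one_mem⟩ (m := 1) (f := id) (fun b hb => hb.1)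
  obtain ⟨B₂, hB₂, hne₂, hcard₂, hdiv₂⟩ :=
    exists_subset_norm_div_sub_one_le hn (hfin.subset hB₁) hne₁
  have hcard₃ : B₂.ncard ≤
      (A ^ 2 ∩ (H ⊓ Subgroup.centralizer (H : Set _) : Subgroup _) : Set _).ncard :=
    Set.ncard_le_of_div_mem ((hA.finite_pow 2).inter_of_left _) hne₂ fun b hb c hc => by
      have hbc := hdiv₁ b (hB₂ hb) c (hB₂ hc)
      have hH : b⁻¹ * c ∈ H := H.mul_mem (H.inv_mem (hB₁ (hB₂ hb)).2) (hB₁ (hB₂ hc)).2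
      exact ⟨hbc, hH, h _ hbc hH (hdiv₂ b hb c hc)⟩
  have hcard₄ : (B₁.ncard : ℝ) ≤ gridCells n *
      (A ^ 2 ∩ (H ⊓ Subgroup.centralizer (H : Set _) : Subgroup _) : Set _).ncard := by
    exact_mod_cast hcard₂.trans (Nat.mul_le_mul_left _ hcard₃)
  have hcard₅ := mul_le_mul_of_nonneg_left hcard₄ hKpos.le
  rw [pow_one] at hcard₁
  linarith

end IsApproxGroup

/-! ### Commuting star-closed spaces of matrices -/

/-- A star-closed space of pairwise commuting `n × n` matrices has dimension at most `n`: the sum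
of one nonzero vector from each joint eigenspace of its self-adjoint elements is separating. -/
theorem Matrix.finrank_le_of_pairwise_commute {n : ℕ}
    (V : Submodule ℂ (Matrix (Fin n) (Fin n) ℂ)) (hstar : ∀ a ∈ V, star a ∈ V)
    (hcomm : ∀ a ∈ V, ∀ b ∈ V, a * b = b * a) : Module.finrank ℂ V ≤ n := by
  classical
  let ι := {h : Matrix (Fin n) (Fin n) ℂ // h ∈ V ∧ IsSelfAdjoint h}
  let E := EuclideanSpace ℂ (Fin n)
  let φ := Matrix.toEuclideanLin (𝕜 := ℂ) (m := Fin n) (n := Fin n)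
  have hφmul : ∀ a b, φ (a * b) = φ a * φ b := fun a b => by
    ext x; simp [φ, Matrix.toEuclideanLin, Matrix.toLpLin_apply]
  let F : ι → E →ₗ[ℂ] E := fun h => φ h.1
  have hsym : ∀ i, (F i).IsSymmetric := fun i =>
    Matrix.isSymmetric_toEuclideanLin_iff.2 i.2.2
  have hFcomm : Pairwise (Function.onFun Commute F) := fun i j _ => by
    change φ i.1 * φ j.1 = φ j.1 * φ i.1
    rw [← hφmul, ← hφmul, hcomm _ i.2.1 _ j.2.1]
  let W : (ι → ℂ) → Submodule ℂ E := fun χ => ⨅ i, Module.End.eigenspace (F i) (χ i)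
  have htop : ⨆ χ, W χ = ⊤ := LinearMap.IsSymmetric.iSup_iInf_eq_top_of_commute hsym hFcomm
  have hind : iSupIndep W :=
    (LinearMap.IsSymmetric.orthogonalFamily_iInf_eigenspaces hsym).independent
  -- Every element of `V` acts on every joint eigenspace by a scalar.
  have hscalar : ∀ a ∈ V, ∀ χ, ∃ c : ℂ, ∀ x ∈ W χ, φ a x = c • x := by
    intro a ha χ
    have hre : ((realPart a : selfAdjoint _) : Matrix (Fin n) (Fin n) ℂ) ∈ V := by
      rw [realPart_apply_coe]
      exact V.smul_of_tower_mem _ (V.add_mem ha (hstar a ha))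
    have him : ((imaginaryPart a : selfAdjoint _) : Matrix (Fin n) (Fin n) ℂ) ∈ V := by
      rw [imaginaryPart_apply_coe]
      exact V.smul_mem _ (V.smul_of_tower_mem _ (V.sub_mem ha (hstar a ha)))
    refine ⟨χ ⟨_, hre, (realPart a).2⟩ + Complex.I * χ ⟨_, him, (imaginaryPart a).2⟩,
      fun x hx => ?_⟩
    have h1 := Module.End.mem_eigenspace_iff.1 ((Submodule.mem_iInf _).1 hx
      ⟨_, hre, (realPart a).2⟩)
    have h2 := Module.End.mem_eigenspace_iff.1 ((Submodule.mem_iInf _).1 hx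
      ⟨_, him, (imaginaryPart a).2⟩)
    conv_lhs => rw [← realPart_add_I_smul_imaginaryPart a]
    rw [map_add, map_smul, LinearMap.add_apply, LinearMap.smul_apply, add_smul, mul_smul]
    exact congrArg₂ (· + Complex.I • ·) h1 h2
  let J := {χ // W χ ≠ ⊥}
  let : Fintype J := hind.fintypeNeBotOfFiniteDimensional
  have hv : ∀ χ : J, ∃ x ∈ W χ.1, x ≠ 0 := fun χ => (Submodule.ne_bot_iff _).1 χ.2
  choose v hvW hv0 using hv
  have hlin : LinearIndependent ℂ v :=
    (hind.comp Subtype.coe_injective).linearIndependent _ hvW hv0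
  let Φ : V →ₗ[ℂ] E := (LinearMap.applyₗ (∑ χ, v χ)).comp (φ.toLinearMap.comp V.subtype)
  have hinj : Function.Injective Φ := by
    rw [← LinearMap.ker_eq_bot, LinearMap.ker_eq_bot']
    rintro ⟨a, ha⟩ h0
    choose c hc using hscalar a ha
    have h1 : ∑ χ : J, c χ.1 • v χ = 0 := by
      have : φ a (∑ χ, v χ) = 0 := h0
      rw [map_sum] at this
      rw [← this]
      exact Finset.sum_congr rfl fun χ _ => (hc χ.1 _ (hvW χ)).symm
    have h2 := Fintype.linearIndependent_iff.1 hlin (fun χ => c χ.1) h1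
    have h3 : (⊤ : Submodule ℂ E) ≤ LinearMap.ker (φ a) := by
      rw [← htop]
      refine iSup_le fun χ x hx => ?_
      rw [LinearMap.mem_ker, hc χ x hx]
      by_cases hχ : W χ = ⊥
      · rw [hχ] at hx
        rw [(Submodule.mem_bot ℂ).1 hx, smul_zero]
      · rw [h2 ⟨χ, hχ⟩, zero_smul]
    have h4 : φ a = 0 := LinearMap.ker_eq_top.1 (top_le_iff.1 h3)
    exact Subtype.ext (φ.injective (h4.trans (map_zero φ).symm))
  calc Module.finrank ℂ V ≤ Module.finrank ℂ E := LinearMap.finrank_le_finrank_of_injective hinj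
    _ = n := by simp [E]

/-! ### Subgroups cut out by linear conditions -/

section LinearSpan

variable {n : ℕ}

/-- The complex span, in the space of all matrices, of a subgroup of the unitary group. -/
def Subgroup.linearSpan (T : Subgroup (Matrix.unitaryGroup (Fin n) ℂ)) :
    Submodule ℂ (Matrix (Fin n) (Fin n) ℂ) :=
  Submodule.span ℂ ((↑) '' (T : Set (Matrix.unitaryGroup (Fin n) ℂ)))

/-- A subgroup of the unitary group is linearly closed if it contains all unitary matrices in
its complex span, that is, if it is the unitary group of a star-subalgebra. -/
def Subgroup.IsLinearlyClosed (T : Subgroup (Matrix.unitaryGroup (Fin n) ℂ)) : Prop :=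
  ∀ u : Matrix.unitaryGroup (Fin n) ℂ, (u : Matrix (Fin n) (Fin n) ℂ) ∈ T.linearSpan → u ∈ T

namespace Subgroup

variable {S T : Subgroup (Matrix.unitaryGroup (Fin n) ℂ)}

theorem coe_mem_linearSpan {u : Matrix.unitaryGroup (Fin n) ℂ} (hu : u ∈ T) :
    (u : Matrix (Fin n) (Fin n) ℂ) ∈ T.linearSpan :=
  Submodule.subset_span ⟨u, hu, rfl⟩

theorem linearSpan_le {V : Submodule ℂ (Matrix (Fin n) (Fin n) ℂ)}
    (h : ∀ u ∈ T, (u : Matrix (Fin n) (Fin n) ℂ) ∈ V) : T.linearSpan ≤ V :=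
  Submodule.span_le.2 (by rintro _ ⟨u, hu, rfl⟩; exact h u hu)

theorem linearSpan_mono (h : S ≤ T) : S.linearSpan ≤ T.linearSpan :=
  linearSpan_le fun _ hu => coe_mem_linearSpan (h hu)

/-- The complex span of a group of unitary matrices is a star-subalgebra. -/
def linearSpanAlgebra (T : Subgroup (Matrix.unitaryGroup (Fin n) ℂ)) :
    StarSubalgebra ℂ (Matrix (Fin n) (Fin n) ℂ) where
  carrier := T.linearSpan
  mul_mem' {a b} ha hb := by
    have h1 : ∀ u ∈ T, (u : Matrix (Fin n) (Fin n) ℂ) * b ∈ T.linearSpan := fun u hu =>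
      linearSpan_le (V := T.linearSpan.comap (LinearMap.mulLeft ℂ u.1))
        (fun v hv => coe_mem_linearSpan (T.mul_mem hu hv)) hb
    exact linearSpan_le (V := T.linearSpan.comap (LinearMap.mulRight ℂ b)) h1 ha
  add_mem' := T.linearSpan.add_mem
  algebraMap_mem' r := by
    rw [Algebra.algebraMap_eq_smul_one]
    exact T.linearSpan.smul_mem r (coe_mem_linearSpan T.one_mem)
  star_mem' {a} ha := by
    induction ha using Submodule.span_induction with
    | mem x hx =>
      obtain ⟨u, hu, rfl⟩ := hx
      exact coe_mem_linearSpan (T.inv_mem hu)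
    | zero => rw [star_zero]; exact T.linearSpan.zero_mem
    | add x y _ _ hx hy => rw [star_add]; exact T.linearSpan.add_mem hx hy
    | smul r x _ hx => rw [star_smul]; exact T.linearSpan.smul_mem _ hx

theorem mul_eq_mul_of_mem_linearSpan {a b : Matrix (Fin n) (Fin n) ℂ} (ha : a ∈ T.linearSpan)
    (h : ∀ u ∈ T, (u : Matrix (Fin n) (Fin n) ℂ) * b = b * u) : a * b = b * a :=
  linearSpan_le (V := LinearMap.eqLocus (LinearMap.mulRight ℂ b) (LinearMap.mulLeft ℂ b)) h ha

theorem finrank_linearSpan_le (hT : ∀ x ∈ T, ∀ y ∈ T, x * y = y * x) :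
    Module.finrank ℂ T.linearSpan ≤ n := by
  refine Matrix.finrank_le_of_pairwise_commute _ (fun a ha => T.linearSpanAlgebra.star_mem' ha)
    fun a ha b hb => mul_eq_mul_of_mem_linearSpan ha fun u hu => ?_
  refine (mul_eq_mul_of_mem_linearSpan hb fun v hv => ?_).symm
  exact congrArg Subtype.val (hT v hv u hu)

theorem isLinearlyClosed_top : (⊤ : Subgroup (Matrix.unitaryGroup (Fin n) ℂ)).IsLinearlyClosed :=
  fun _ _ => mem_top _

theorem IsLinearlyClosed.inf (hS : S.IsLinearlyClosed) (hT : T.IsLinearlyClosed) :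
    (S ⊓ T).IsLinearlyClosed := fun u hu =>
  ⟨hS u (linearSpan_mono inf_le_left hu), hT u (linearSpan_mono inf_le_right hu)⟩

theorem isLinearlyClosed_centralizer (X : Set (Matrix.unitaryGroup (Fin n) ℂ)) :
    (centralizer X).IsLinearlyClosed := fun u hu => by
  refine mem_centralizer_iff.2 fun x hx => ?_
  refine Subtype.ext (mul_eq_mul_of_mem_linearSpan hu fun v hv => ?_).symm
  exact congrArg Subtype.val (mem_centralizer_iff.1 hv x hx).symm

theorem IsLinearlyClosed.finrank_lt (hS : S.IsLinearlyClosed) (h : S < T) :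
    Module.finrank ℂ S.linearSpan < Module.finrank ℂ T.linearSpan := by
  refine Submodule.finrank_lt_finrank_of_lt (lt_of_le_of_ne (linearSpan_mono h.le) fun heq => ?_)
  exact h.not_ge fun u hu => hS u (heq ▸ coe_mem_linearSpan hu)

theorem linearSpan_conj (T : Subgroup (Matrix.unitaryGroup (Fin n) ℂ))
    (w : Matrix.unitaryGroup (Fin n) ℂ) :
    (T.map (MulAut.conj w).toMonoidHom).linearSpan = T.linearSpan.map
      ((LinearMap.mulLeft ℂ (w : Matrix (Fin n) (Fin n) ℂ)).comp
        (LinearMap.mulRight ℂ ((w⁻¹ : Matrix.unitaryGroup (Fin n) ℂ) :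
          Matrix (Fin n) (Fin n) ℂ))) := by
  rw [linearSpan, linearSpan, Submodule.map_span, Set.image_image, coe_map, Set.image_image]
  congr 1
  refine Set.image_congr fun u _ => ?_
  simp [mul_assoc]

theorem finrank_linearSpan_conj_le (T : Subgroup (Matrix.unitaryGroup (Fin n) ℂ))
    (w : Matrix.unitaryGroup (Fin n) ℂ) :
    Module.finrank ℂ (T.map (MulAut.conj w).toMonoidHom).linearSpan ≤
      Module.finrank ℂ T.linearSpan := by
  rw [linearSpan_conj]
  exact Submodule.finrank_map_le _ _

theorem IsLinearlyClosed.conj (hT : T.IsLinearlyClosed) (w : Matrix.unitaryGroup (Fin n) ℂ) :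
    (T.map (MulAut.conj w).toMonoidHom).IsLinearlyClosed := fun u hu => by
  refine mem_map.2 ⟨w⁻¹ * u * w, hT _ ?_, by simp [mul_assoc]⟩
  rw [linearSpan_conj] at hu
  obtain ⟨a, ha, hau⟩ := hu
  have h : a = ((w⁻¹ * u * w : Matrix.unitaryGroup (Fin n) ℂ) : Matrix (Fin n) (Fin n) ℂ) := by
    rw [Submonoid.coe_mul, Submonoid.coe_mul, ← hau]
    have h1 : ((w⁻¹ : Matrix.unitaryGroup (Fin n) ℂ) : Matrix (Fin n) (Fin n) ℂ) * w = 1 := by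
      rw [← Submonoid.coe_mul, inv_mul_cancel]; rfl
    simp only [LinearMap.comp_apply, LinearMap.mulLeft_apply, LinearMap.mulRight_apply]
    rw [← mul_assoc, h1, one_mul, mul_assoc, h1, mul_one]
  exact h ▸ ha

/-- A linearly closed subgroup cannot be properly contained in a conjugate of itself. -/
theorem IsLinearlyClosed.conj_eq_of_le (hS : S.IsLinearlyClosed)
    {a : Matrix.unitaryGroup (Fin n) ℂ} (h : S ≤ S.map (MulAut.conj a).toMonoidHom) :
    S.map (MulAut.conj a).toMonoidHom = S := by
  by_contra hne
  exact (finrank_linearSpan_conj_le S a).not_gt (hS.finrank_lt (lt_of_le_of_ne h (Ne.symm hne)))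

/-- A linearly closed subgroup is connected: for `u` in it, the path `t ↦ exp (i t arg u)` joins
`1` to `u` and remains in the algebra generated by `u`. -/
theorem IsLinearlyClosed.isConnected (hS : S.IsLinearlyClosed) :
    IsConnected (S : Set (Matrix.unitaryGroup (Fin n) ℂ)) := by
  refine IsPathConnected.isConnected ⟨1, S.one_mem, fun {u} hu => ?_⟩
  -- The spectrum of `u` is finite, so `arg` is continuous on it, even across the branch cut.
  have harg : ContinuousOn Complex.arg (spectrum ℂ (u : Matrix (Fin n) (Fin n) ℂ)) :=
    (Matrix.finite_spectrum _).continuousOn _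
  have hexp : selfAdjoint.expUnitary (Unitary.argSelfAdjoint u) = u := by
    refine Subtype.ext ?_
    have hcomp := cfc_comp' (fun z : ℂ => NormedSpace.exp (Complex.I • z))
      (fun z : ℂ => (Complex.arg z : ℂ)) (u : Matrix (Fin n) (Fin n) ℂ)
      (hf := (Matrix.finite_spectrum _).continuousOn _)
    have hsmul := cfc_comp_smul Complex.I (NormedSpace.exp : ℂ → ℂ)
      (cfc (fun z : ℂ => (Complex.arg z : ℂ)) (u : Matrix (Fin n) (Fin n) ℂ))
    rw [selfAdjoint.expUnitary_coe, Unitary.argSelfAdjoint_coe,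
      ← CFC.exp_eq_normedSpace_exp (𝕜 := ℂ), ← hsmul, ← hcomp]
    conv_rhs => rw [← cfc_id' ℂ (u : Matrix (Fin n) (Fin n) ℂ)]
    refine cfc_congr fun y hy => ?_
    have hy₁ : ‖y‖ = 1 := spectrum.norm_eq_one_of_unitary u.2 hy
    simpa [← Complex.exp_eq_exp_ℂ, hy₁, mul_comm] using Complex.norm_mul_exp_arg_mul_I y
  have hmem : ((Unitary.argSelfAdjoint u : selfAdjoint _) : Matrix (Fin n) (Fin n) ℂ) ∈
      S.linearSpanAlgebra := by
    rw [Unitary.argSelfAdjoint_coe]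
    have hclosed : IsClosed (S.linearSpanAlgebra : Set (Matrix (Fin n) (Fin n) ℂ)) :=
      S.linearSpan.closed_of_finiteDimensional
    exact StarAlgebra.elemental.le_of_mem hclosed (coe_mem_linearSpan hu) (cfc_mem_elemental _ _)
  have hpath : JoinedIn (S : Set (Matrix.unitaryGroup (Fin n) ℂ)) 1
      (selfAdjoint.expUnitary (Unitary.argSelfAdjoint u)) := by
    refine ⟨selfAdjoint.expUnitaryPathToOne (Unitary.argSelfAdjoint u), fun t => hS _ ?_⟩
    have hclosed : IsClosed (S.linearSpanAlgebra : Set (Matrix (Fin n) (Fin n) ℂ)) :=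
      S.linearSpan.closed_of_finiteDimensional
    rw [selfAdjoint.expUnitaryPathToOne_apply, selfAdjoint.expUnitary_coe]
    exact NormedSpace.exp_mem hclosed (S.linearSpanAlgebra.smul_mem
      (S.linearSpan.smul_of_tower_mem (t : ℝ) hmem) Complex.I)
  exact hexp ▸ hpath

end Subgroup

end LinearSpan

/-! ### A dense torus, and its intersection with conjugates -/

theorem Subgroup.mem_map_conj {G : Type*} [Group G] {T : Subgroup G} {w x : G} :
    x ∈ T.map (MulAut.conj w).toMonoidHom ↔ w⁻¹ * x * w ∈ T := by
  rw [Subgroup.mem_map_equiv, MulAut.conj_symm_apply]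

namespace IsApproxGroup

variable {n : ℕ} {K : ℝ} {A : Set (Matrix.unitaryGroup (Fin n) ℂ)}

theorem one_le_gridCells_mul_pow (hA : IsApproxGroup K A) : 1 ≤ gridCells n * K ^ 14 := by
  have h1 : (1 : ℝ) ≤ gridCells n := by exact_mod_cast gridCells_pos n
  have h2 : 1 ≤ K ^ 14 := one_le_pow₀ hA.one_le
  exact one_le_mul_of_one_le_of_one_le h1 h2

/-- Replacing `H` by the centraliser in `H` of a non-central element of minimal distance to `1`
strictly enlarges the span of the centre, whose dimension is at most `n`. So at most `d` such
replacements are possible if the centre of `H` has dimension at least `n - d`, and thereafter most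
of `A ^ 2 ∩ H` is central. -/
theorem exists_isLinearlyClosed_commutative (hA : IsApproxGroup K A) (hn : 1 ≤ n) (d : ℕ)
    (H : Subgroup (Matrix.unitaryGroup (Fin n) ℂ)) (hH : H.IsLinearlyClosed)
    (hd : n ≤ d + Module.finrank ℂ (H ⊓ Subgroup.centralizer (H : Set _)).linearSpan) :
    ∃ T : Subgroup (Matrix.unitaryGroup (Fin n) ℂ), T.IsLinearlyClosed ∧
      (∀ x ∈ T, ∀ y ∈ T, x * y = y * x) ∧
      ((A ^ 2 ∩ H : Set _).ncard : ℝ) ≤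
        (gridCells n * K ^ 14) ^ (d + 1) * (A ^ 2 ∩ T : Set _).ncard := by
  have hKpos := hA.pos
  have hQ := hA.one_le_gridCells_mul_pow
  induction d using Nat.strong_induction_on generalizing H with
  | _ d ih =>
  by_cases hc : ∀ z ∈ A ^ 2, z ∈ H → ‖(z : Matrix (Fin n) (Fin n) ℂ) - 1‖ ≤ 1 / 8 →
      z ∈ Subgroup.centralizer (H : Set _)
  · refine ⟨_, hH.inf (Subgroup.isLinearlyClosed_centralizer _), fun x hx y hy =>
      Subgroup.mem_centralizer_iff.1 hy.2 x hx.1, ?_⟩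
    refine (hA.ncard_inter_le_ncard_inter_center hn hc).trans
      (mul_le_mul_of_nonneg_right ?_ (Nat.cast_nonneg _))
    refine le_trans ?_ (le_self_pow₀ hQ d.succ_ne_zero)
    exact mul_le_mul_of_nonneg_left (le_self_pow₀ hA.one_le (by norm_num)) (Nat.cast_nonneg _)
  · let B := {z ∈ A ^ 2 | z ∈ H ∧ ‖(z : Matrix (Fin n) (Fin n) ℂ) - 1‖ ≤ 1 / 8 ∧
      z ∉ Subgroup.centralizer (H : Set _)}
    have hBne : B.Nonempty := by
      push Not at hc
      obtain ⟨z, h1, h2, h3, h4⟩ := hc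
      exact ⟨z, h1, h2, h3, h4⟩
    obtain ⟨v, ⟨hvA, hvH, hv, hvc⟩, hmin⟩ := Set.exists_min_image B
      (fun z => ‖(z : Matrix (Fin n) (Fin n) ℂ) - 1‖)
      ((hA.finite_pow 2).subset (Set.sep_subset _ _)) hBne
    have hstep := hA.ncard_inter_le_ncard_inter_centralizer hn hvA hvH hvc hv
      (fun z hzA hzH hz => by
        by_contra hzc
        exact (hmin z ⟨hzA, hzH, hz.le.trans hv, hzc⟩).not_gt hz)
    set H' := H ⊓ Subgroup.centralizer {v} with hH'def
    have hH' : H'.IsLinearlyClosed := hH.inf (Subgroup.isLinearlyClosed_centralizer _)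
    have hlt : H ⊓ Subgroup.centralizer (H : Set _) <
        H' ⊓ Subgroup.centralizer (H' : Set _) := by
      refine lt_of_le_of_ne (fun x hx => ⟨⟨hx.1, ?_⟩, ?_⟩) fun heq => ?_
      · refine Subgroup.mem_centralizer_iff.2 ?_
        rintro _ rfl
        exact Subgroup.mem_centralizer_iff.1 hx.2 _ hvH
      · exact Subgroup.mem_centralizer_iff.2 fun y hy =>
          Subgroup.mem_centralizer_iff.1 hx.2 y hy.1
      · have hvH' : v ∈ H' ⊓ Subgroup.centralizer (H' : Set _) := by
          refine ⟨⟨hvH, ?_⟩, ?_⟩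
          · refine Subgroup.mem_centralizer_iff.2 ?_
            rintro _ rfl
            rfl
          · exact Subgroup.mem_centralizer_iff.2 fun y hy =>
              (Subgroup.mem_centralizer_iff.1 hy.2 v rfl).symm
        rw [← heq] at hvH'
        exact hvc hvH'.2
    have hdim := (hH.inf (Subgroup.isLinearlyClosed_centralizer _)).finrank_lt hlt
    have hdim' : Module.finrank ℂ (H' ⊓ Subgroup.centralizer (H' : Set _)).linearSpan ≤ n :=
      Subgroup.finrank_linearSpan_le fun x hx y hy =>
        Subgroup.mem_centralizer_iff.1 hy.2 x hx.1
    obtain ⟨T, hT, hTcomm, hTcard⟩ := ih (d - 1) (by omega) H' hH' (by omega)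
    refine ⟨T, hT, hTcomm, hstep.trans ?_⟩
    have hd1 : d - 1 + 1 = d := by omega
    rw [hd1] at hTcard
    rw [pow_succ' _ d, mul_assoc (gridCells n * K ^ 14 : ℝ)]
    exact mul_le_mul_of_nonneg_left hTcard (by positivity)

/-- A subgroup which is the intersection of conjugates of `T` by words of length `j` is either
normalised by `A`, or properly cut by the conjugate of `T` by some word of length `j + 1`. The
dimension of its span drops in the second case, so this ends after at most `d` steps. -/
theorem exists_isLinearlyClosed_normalized (hA : IsApproxGroup K A)
    {T : Subgroup (Matrix.unitaryGroup (Fin n) ℂ)} (hT : T.IsLinearlyClosed) {D : ℝ} (hD : 1 ≤ D)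
    (hTD : (A.ncard : ℝ) ≤ D * (A ^ 2 ∩ T : Set _).ncard) (d j : ℕ) (hdj : j + d ≤ n)
    (S : Subgroup (Matrix.unitaryGroup (Fin n) ℂ)) (hS : S.IsLinearlyClosed)
    (F : Set (Matrix.unitaryGroup (Fin n) ℂ)) (hF : F ⊆ A ^ j)
    (hSF : ∀ x, x ∈ S ↔ ∀ w ∈ F, w⁻¹ * x * w ∈ T)
    (hd : Module.finrank ℂ S.linearSpan ≤ d) :
    ∃ S' ≤ S, S'.IsLinearlyClosed ∧
      A ⊆ (Subgroup.normalizer (S' : Set (Matrix.unitaryGroup (Fin n) ℂ)) : Set _) ∧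
      ((A ^ 2 ∩ S : Set _).ncard : ℝ) ≤
        (D * K ^ (2 * n + 7)) ^ d * (A ^ 2 ∩ S' : Set _).ncard := by
  have hKpos := hA.pos
  have hR : 1 ≤ D * K ^ (2 * n + 7) :=
    one_le_mul_of_one_le_of_one_le hD (one_le_pow₀ hA.one_le)
  induction d using Nat.strong_induction_on generalizing j S F with
  | _ d ih =>
  by_cases hnorm : ∀ a ∈ A, S ≤ S.map (MulAut.conj a).toMonoidHom
  · refine ⟨S, le_rfl, hS, fun a ha => ?_, ?_⟩
    · rw [SetLike.mem_coe, Subgroup.mem_normalizer_iff]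
      intro x
      have hconj := hS.conj_eq_of_le (hnorm a ha)
      conv_rhs => rw [← hconj]
      rw [Subgroup.mem_map_conj]
      simp [mul_assoc]
    · exact le_mul_of_one_le_left (Nat.cast_nonneg _) (one_le_pow₀ hR)
  · push Not at hnorm
    obtain ⟨a, ha, hSa⟩ := hnorm
    obtain ⟨w, hwF, hSw⟩ : ∃ w ∈ F, ¬ S ≤ T.map (MulAut.conj (a * w)).toMonoidHom := by
      by_contra! hall
      refine hSa fun x hx => Subgroup.mem_map_conj.2 ((hSF _).2 fun w hw => ?_)
      have h := Subgroup.mem_map_conj.1 (hall w hw hx)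
      convert h using 1
      group
    have haw : a * w ∈ A ^ (j + 1) := by
      rw [pow_succ']
      exact Set.mul_mem_mul ha (hF hwF)
    set T' := T.map (MulAut.conj (a * w)).toMonoidHom with hT'
    have hlt : S ⊓ T' < S := lt_of_le_of_ne inf_le_left fun h => hSw (inf_eq_left.1 h)
    have hclosed : (S ⊓ T').IsLinearlyClosed := hS.inf (hT.conj _)
    have hdim := hclosed.finrank_lt hlt
    obtain ⟨S', hS', hS'closed, hS'norm, hS'card⟩ := ih (d - 1) (by omega) (j + 1) (by omega)
      (S ⊓ T') hclosed (insert (a * w) F)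
      (Set.insert_subset haw (hF.trans (hA.pow_subset_pow (Nat.le_succ j))))
      (fun x => by
        rw [Subgroup.mem_inf, hSF, Set.forall_mem_insert, and_comm]
        refine and_congr_left fun _ => ?_
        rw [hT', Subgroup.mem_map_conj]) (by omega)
    refine ⟨S', hS'.trans inf_le_left, hS'closed, hS'norm, ?_⟩
    -- `T'` has density at least `1 / (D * K ^ (2 * n + 1))` in `A`.
    have hT'card : (A.ncard : ℝ) ≤ D * (K ^ (2 * n + 1) * (A ^ 2 ∩ T' : Set _).ncard) := by
      refine hTD.trans (mul_le_mul_of_nonneg_left ?_ (by linarith))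
      exact hA.ncard_inter_le_ncard_inter_conj T
        (hA.pow_subset_pow (show j + 1 ≤ n by omega) haw)
    have hApos : (0 : ℝ) < A.ncard := by
      exact_mod_cast (Set.ncard_pos hA.finite).2 ⟨1, hA.one_mem⟩
    have hinter := hA.ncard_inter_mul_ncard_inter_le S T'
    have key : ∀ s t u a : ℝ, 0 < a → 0 ≤ s → a ≤ D * (K ^ (2 * n + 1) * t) →
        s * t ≤ K ^ 6 * a * u → s ≤ D * K ^ (2 * n + 7) * u := by
      intro s t u a ha hs h1 h2
      refine le_of_mul_le_mul_right ?_ ha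
      calc s * a ≤ s * (D * (K ^ (2 * n + 1) * t)) := mul_le_mul_of_nonneg_left h1 hs
        _ = D * K ^ (2 * n + 1) * (s * t) := by ring
        _ ≤ D * K ^ (2 * n + 1) * (K ^ 6 * a * u) :=
          mul_le_mul_of_nonneg_left h2 (by positivity)
        _ = D * K ^ (2 * n + 7) * u * a := by ring
    have hstep := key _ _ _ _ hApos (Nat.cast_nonneg _) hT'card hinter
    refine hstep.trans ?_
    have hd1 : d = d - 1 + 1 := by omega
    rw [hd1, pow_succ' _ (d - 1), mul_assoc (D * K ^ (2 * n + 7))]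
    exact mul_le_mul_of_nonneg_left hS'card (by positivity)

/-- The main estimate, with an explicit constant and natural-number exponents. For `n = 1` the
whole group is abelian; for `n ≥ 2` the constants are absorbed into powers of `n`. -/
theorem exists_isConnected_commutative_normalized (hA : IsApproxGroup K A) (hn : 1 ≤ n) :
    ∃ S : Subgroup (Matrix.unitaryGroup (Fin n) ℂ),
      IsConnected (S : Set (Matrix.unitaryGroup (Fin n) ℂ)) ∧
      (∀ x ∈ S, ∀ y ∈ S, x * y = y * x) ∧
      A ⊆ (Subgroup.normalizer (S : Set (Matrix.unitaryGroup (Fin n) ℂ)) : Set _) ∧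
      ((imageInNormalizerQuotient S A).ncard : ℝ) ≤
        (n : ℝ) ^ (100 * n ^ 4) * K ^ (100 * n ^ 2) := by
  have hKpos := hA.pos
  have hA2 : (A.ncard : ℝ) ≤ (A ^ 2 ∩ ((⊤ : Subgroup (Matrix.unitaryGroup (Fin n) ℂ)) : Set _) : Set _).ncard := by
    rw [Subgroup.coe_top, Set.inter_univ]
    exact_mod_cast Set.ncard_le_ncard
      (by simpa using hA.pow_subset_pow (show 1 ≤ 2 by norm_num)) (hA.finite_pow 2)
  obtain rfl | hn2 := hn.eq_or_lt
  · refine ⟨⊤, Subgroup.isLinearlyClosed_top.isConnected, fun x _ y _ => ?_, ?_, ?_⟩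
    · refine Subtype.ext (Matrix.ext fun i j => ?_)
      simp [Matrix.mul_apply, Fin.fin_one_eq_zero, mul_comm]
    · intro a _
      rw [SetLike.mem_coe, Subgroup.mem_normalizer_iff]
      simp
    · have h1 := hA.ncard_image_mul_ncard_inter_le ⊤
      have h2 : (0 : ℝ) < (A ^ 2 ∩ ((⊤ : Subgroup (Matrix.unitaryGroup (Fin 1) ℂ)) : Set _) : Set _).ncard := by
        exact_mod_cast hA.ncard_sq_inter_pos ⊤
      have h3 : ((imageInNormalizerQuotient (⊤ : Subgroup (Matrix.unitaryGroup (Fin 1) ℂ)) A).ncard : ℝ) ≤ K ^ 2 :=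
        le_of_mul_le_mul_right
          (h1.trans (mul_le_mul_of_nonneg_left hA2 (by positivity))) h2
      simpa using h3.trans (pow_le_pow_right₀ hA.one_le (by norm_num : 2 ≤ 100))
  · set Q := gridCells n * K ^ 14 with hQdef
    have hQ : 1 ≤ Q := hA.one_le_gridCells_mul_pow
    obtain ⟨T, hT, hTcomm, hTcard⟩ := hA.exists_isLinearlyClosed_commutative hn n ⊤
      Subgroup.isLinearlyClosed_top (Nat.le_add_right _ _)
    obtain ⟨S, hST, hS, hSnorm, hScard⟩ := hA.exists_isLinearlyClosed_normalized hT
      (one_le_pow₀ hQ) (hA2.trans hTcard) n 0 (by omega) T hT {1} (by simp) (by simp)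
      (Subgroup.finrank_linearSpan_le hTcomm)
    refine ⟨S, hS.isConnected, fun x hx y hy => hTcomm x (hST hx) y (hST hy), hSnorm, ?_⟩
    have hpos : (0 : ℝ) < (A ^ 2 ∩ S : Set _).ncard := by
      exact_mod_cast hA.ncard_sq_inter_pos S
    have himage : ((imageInNormalizerQuotient S A).ncard : ℝ) ≤
        K ^ 2 * (Q ^ (n + 1) * (Q ^ (n + 1) * K ^ (2 * n + 7)) ^ n) := by
      refine le_of_mul_le_mul_right ((hA.ncard_image_mul_ncard_inter_le S).trans ?_) hpos
      rw [mul_assoc (K ^ 2), mul_assoc (Q ^ (n + 1))]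
      refine mul_le_mul_of_nonneg_left ((hA2.trans hTcard).trans ?_) (by positivity)
      exact mul_le_mul_of_nonneg_left hScard (by positivity)
    have hN : (gridCells n : ℝ) ≤ (n : ℝ) ^ (16 * n ^ 2) := by
      exact_mod_cast gridCells_le hn2
    have hn1 : (1 : ℝ) ≤ n := by exact_mod_cast hn
    calc ((imageInNormalizerQuotient S A).ncard : ℝ)
        ≤ K ^ 2 * (Q ^ (n + 1) * (Q ^ (n + 1) * K ^ (2 * n + 7)) ^ n) := himage
      _ = (gridCells n : ℝ) ^ ((n + 1) ^ 2) * K ^ (2 + 14 * (n + 1) ^ 2 + (2 * n + 7) * n) := by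
          rw [hQdef]; ring
      _ ≤ ((n : ℝ) ^ (16 * n ^ 2)) ^ ((n + 1) ^ 2) *
          K ^ (2 + 14 * (n + 1) ^ 2 + (2 * n + 7) * n) := by gcongr
      _ = (n : ℝ) ^ (16 * n ^ 2 * (n + 1) ^ 2) *
          K ^ (2 + 14 * (n + 1) ^ 2 + (2 * n + 7) * n) := by rw [← pow_mul]
      _ ≤ (n : ℝ) ^ (100 * n ^ 4) * K ^ (100 * n ^ 2) := by
          refine mul_le_mul (pow_le_pow_right₀ hn1 ?_) (pow_le_pow_right₀ hA.one_le ?_)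
            (by positivity) (by positivity)
          · calc 16 * n ^ 2 * (n + 1) ^ 2 ≤ 16 * n ^ 2 * (2 * n) ^ 2 := by gcongr; omega
              _ = 64 * n ^ 4 := by ring
              _ ≤ 100 * n ^ 4 := by gcongr; norm_num
          · nlinarith

end IsApproxGroup

end OperatorNorm

theorem corollary1p4 :
    ∃ C : ℝ, 0 < C ∧
      ∀ (n : ℕ), 1 ≤ n → ∀ (K : ℝ) (A : Set (Matrix.unitaryGroup (Fin n) ℂ)),
        IsApproxGroup K A →
        ∃ S : Subgroup (Matrix.unitaryGroup (Fin n) ℂ),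
          IsConnected (S : Set (Matrix.unitaryGroup (Fin n) ℂ)) ∧
          (∀ x ∈ S, ∀ y ∈ S, x * y = y * x) ∧
          A ⊆ (Subgroup.normalizer (S : Set (Matrix.unitaryGroup (Fin n) ℂ)) :
            Set (Matrix.unitaryGroup (Fin n) ℂ)) ∧
          ((imageInNormalizerQuotient S A).ncard : ℝ) ≤
            (n : ℝ) ^ (C * (n : ℝ) ^ 4) * K ^ (C * (n : ℝ) ^ 2) := by
  refine ⟨100, by norm_num, fun n hn K A hA => ?_⟩
  obtain ⟨S, hconn, hcomm, hnorm, hcard⟩ := hA.exists_isConnected_commutative_normalized hn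
  refine ⟨S, hconn, hcomm, hnorm, ?_⟩
  have h4 : (100 : ℝ) * (n : ℝ) ^ 4 = ((100 * n ^ 4 : ℕ) : ℝ) := by push_cast; rfl
  have h2 : (100 : ℝ) * (n : ℝ) ^ 2 = ((100 * n ^ 2 : ℕ) : ℝ) := by push_cast; rfl
  rw [h4, h2, Real.rpow_natCast, Real.rpow_natCast]
  exact hcard
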